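/- Let $F$ be an algebraically closed field of characteristic zero (for instance $F=\mathbb C$) and $K=F(x,y)$. For a finite extension $M$ of $K$ let $M'$ be the space of one-forms $P\,dx+Q\,dy$ with $P,Q\in M$; the differential $d$ of $K$ extends uniquely to $M$, $K'\subseteq M'$, and $K$-automorphisms $\sigma$ of $M$ act on $M'$ by $\sigma(a\,db)=\sigma(a)\,d\sigma(b)$. We say that $\omega\in K'$ satisfies an elementary relation over $M$ if there are $v\in M$, $u_1,\dots,u_m\in M^*$ and $c_1,\dots,c_m\in F$ with $$\Bigl(dv+\sum_i c_i\frac{du_i}{u_i}\Bigr)\wedge\omega=0,\qquad dv+\sum_i c_i\frac{du_i}{u_i}\neq 0 .$$ The form $\omega\in K'$ is *exceptional* if it satisfies an elementary relation over some finite extension of $K$ but none over $K$ itself. It admits a rational first integral if $df\wedge\omega=0$ for some $f\in K\setminus F$. Let $n>1$, let $L=K(\ell)$ be a Galois extension of $K$ of degree $n$ whose Galois group is cyclic with generator $\tau$, and suppose that $\tau(\ell)=\zeta\ell$ with a primitive $n$-th root of unity $\zeta\in F$. Define $\mathrm{Pr}:L'\to L'$ by $\mathrm{Pr}(\xi)=\frac1n\sum_{j=0}^{n-1}\zeta^{-j}\tau^j(\xi)$.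 (a) Let $\tilde\gamma=d\tilde v+\sum_i\tilde c_i\,d\tilde u_i/\tilde u_i$ with $\tilde v\in L$ of trace zero, all $\tilde u_i\in L^*$ of norm one (trace and norm of $L/K$), and $\tilde c_i\in F$. Then $\gamma:=\mathrm{Pr}(\tilde\gamma)$ is again of the form $\gamma=dv+\sum_i c_i\,du_i/u_i$ with $v\in L$ of trace zero, all $u_i\in L^*$ of norm one, and $c_i\in F$; furthermore $\gamma=\ell\,\omega$ for some $\omega\in K'$. (b) If, in (a), $\omega$ does not admit a rational first integral, then $\omega$ is exceptional. (c) Every exceptional form arises in this way. Precisely: if $\omega\in K'$ is exceptional and $\ell\,\omega=dv+\sum_i c_i\,du_i/u_i$ for some $v\in L$, $u_i\in L^*$, $c_i\in F$, then $\ell\,\omega=\mathrm{Pr}(\tilde\gamma)$ for some $\tilde\gamma$ as in (a). Moreover, for every exceptional $\omega\in K'$ there are $n>1$, $\zeta$, $L=K(\ell)$ and $\tau$ as above, and $\tilde\gamma\in L'$ as in (a), with $\mathrm{Pr}(\tilde\gamma)=\ell\,\omega$. -/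

import Mathlib

open scoped KaehlerDifferential IntermediateField TensorProduct

universe u v w

noncomputable section

namespace ElemInt

/-- The field `K = F(x, y)` of rational functions in two variables over `F`. -/
abbrev RatFun (F : Type u) [Field F] : Type u :=
  FractionRing (MvPolynomial (Fin 2) F)

/-! One-forms over an extension field `M` of `K` are the Kähler differentials `Ω[M⁄F]`. For `M`
finite over `K` this is the two-dimensional `M`-vector space with basis `dx, dy`, and
`KaehlerDifferential.D F M` is the unique extension of the usual differential `d` on `K`. -/

/-- The pull-back of one-forms along a homomorphism of `F`-algebras:
`a db ↦ f(a) d(f(b))`. -/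
def formMap (F : Type u) {A : Type v} {B : Type w} [CommRing F] [CommRing A] [CommRing B]
    [Algebra F A] [Algebra F B] (f : A →ₐ[F] B) : Ω[A⁄F] →ₗ[F] Ω[B⁄F] :=
  Ideal.mapCotangent (KaehlerDifferential.ideal F A) (KaehlerDifferential.ideal F B)
    (Algebra.TensorProduct.map f f) (by
      have key : ∀ z, Algebra.TensorProduct.lmul' F (S := B) (Algebra.TensorProduct.map f f z)
          = f (Algebra.TensorProduct.lmul' F (S := A) z) := by
        intro z
        induction z with
        | zero => simp
        | add a b ha hb => simp only [map_add, ha, hb]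
        | tmul a b => simp
      intro z hz
      have hz' : Algebra.TensorProduct.lmul' F (S := A) z = 0 := hz
      change Algebra.TensorProduct.lmul' F (S := B) (Algebra.TensorProduct.map f f z) = 0
      rw [key, hz', map_zero])

theorem formMap_D (F : Type u) {A : Type v} {B : Type w} [CommRing F] [CommRing A] [CommRing B]
    [Algebra F A] [Algebra F B] (f : A →ₐ[F] B) (b : A) :
    formMap F f (KaehlerDifferential.D F A b) = KaehlerDifferential.D F B (f b) := by
  rw [KaehlerDifferential.D_apply, KaehlerDifferential.D_apply]
  unfold formMap
  erw [Ideal.mapCotangent_toCotangent]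
  congr 1
  apply Subtype.ext
  simp

theorem formMap_smul (F : Type u) {A : Type v} {B : Type w} [CommRing F] [CommRing A]
    [CommRing B] [Algebra F A] [Algebra F B] (f : A →ₐ[F] B) (a : A) (ξ : Ω[A⁄F]) :
    formMap F f (a • ξ) = f a • formMap F f ξ := by
  obtain ⟨z, rfl⟩ := Ideal.toCotangent_surjective _ ξ
  have hA : a • (KaehlerDifferential.ideal F A).toCotangent z
      = (KaehlerDifferential.ideal F A).toCotangent ((a ⊗ₜ[F] (1 : A)) • z) := by
    rw [map_smul]
    exact (algebraMap_smul (TensorProduct F A A) a _).symm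
  have hB : ∀ y, f a • (KaehlerDifferential.ideal F B).toCotangent y
      = (KaehlerDifferential.ideal F B).toCotangent ((f a ⊗ₜ[F] (1 : B)) • y) := by
    intro y
    rw [map_smul]
    exact (algebraMap_smul (TensorProduct F B B) (f a) _).symm
  unfold formMap
  erw [hA, Ideal.mapCotangent_toCotangent, Ideal.mapCotangent_toCotangent, hB]
  congr 1
  apply Subtype.ext
  simp

/-- The vanishing of the wedge product `α ∧ β` of two one-forms over `M`. -/
def WedgeEqZero (F : Type u) {M : Type v} [Field F] [Field M] [Algebra F M]
    (α β : Ω[M⁄F]) : Prop :=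
  ExteriorAlgebra.ι M α * ExteriorAlgebra.ι M β = 0

/-- The one-form `dv + ∑ cᵢ duᵢ / uᵢ`. -/
def elemForm {F : Type u} {M : Type v} [Field F] [Field M] [Algebra F M] {m : ℕ}
    (v : M) (c : Fin m → F) (u : Fin m → Mˣ) : Ω[M⁄F] :=
  KaehlerDifferential.D F M v
    + ∑ i, c i • ((u i : M)⁻¹ • KaehlerDifferential.D F M (u i : M))

section Extension

variable (F : Type u) [Field F] (M : Type v) [Field M] [Algebra F M] [Algebra (RatFun F) M]
  [IsScalarTower F (RatFun F) M]

/-- A one-form over `K`, regarded as a one-form over the extension field `M`. -/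
def extendForm (ω : Ω[RatFun F⁄F]) : Ω[M⁄F] :=
  KaehlerDifferential.map F F (RatFun F) M ω

/-- There are `v ∈ M`, `uᵢ ∈ Mˣ` and constants `cᵢ` with
`(dv + ∑ cᵢ duᵢ / uᵢ) ∧ ω = 0` and `dv + ∑ cᵢ duᵢ / uᵢ ≠ 0`. -/
def HasElementaryRelation (ω : Ω[RatFun F⁄F]) : Prop :=
  ∃ (m : ℕ) (v : M) (c : Fin m → F) (u : Fin m → Mˣ),
    elemForm v c u ≠ 0 ∧ WedgeEqZero F (elemForm v c u) (extendForm F M ω)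

end Extension

/-- `ω` has a first integral `f ∈ K`, not a constant. -/
def HasRationalFirstIntegral (F : Type u) [Field F] (ω : Ω[RatFun F⁄F]) : Prop :=
  ∃ f : RatFun F, f ∉ Set.range (algebraMap F (RatFun F)) ∧
    WedgeEqZero F (KaehlerDifferential.D F (RatFun F) f) ω

/-- `ω` is exceptional: it satisfies an elementary relation over some finite extension of `K`, but
none over `K` itself. -/
def IsExceptional (F : Type u) [Field F] (ω : Ω[RatFun F⁄F]) : Prop :=
  (∃ (M : Type u) (_ : Field M) (_ : Algebra F M) (_ : Algebra (RatFun F) M)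
      (_ : IsScalarTower F (RatFun F) M),
      FiniteDimensional (RatFun F) M ∧ HasElementaryRelation F M ω) ∧
    ¬ HasElementaryRelation F (RatFun F) ω

section Cyclic

variable {F : Type u} [Field F] {L : Type v} [Field L] [Algebra F L] [Algebra (RatFun F) L]

/-- `L = K(ℓ)` is a cyclic Galois extension of `K` of degree `n > 1`, its Galois group is
generated by `τ`, and `τ(ℓ) = ζ ℓ` with a primitive `n`-th root of unity `ζ`. -/
structure IsCyclicSetting (n : ℕ) (ζ : F) (τ : L ≃ₐ[RatFun F] L) (ℓ : L) : Prop where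
  one_lt : 1 < n
  finrank_eq : Module.finrank (RatFun F) L = n
  isGalois : IsGalois (RatFun F) L
  generates : ∀ σ : L ≃ₐ[RatFun F] L, σ ∈ Subgroup.zpowers τ
  isPrimitiveRoot : IsPrimitiveRoot ζ n
  adjoin_eq_top : (RatFun F)⟮ℓ⟯ = ⊤
  map_eq : τ ℓ = ζ • ℓ

/-- `γ = dv + ∑ cᵢ duᵢ / uᵢ` with `v ∈ L` of trace zero, all `uᵢ ∈ Lˣ` of norm one, and
constants `cᵢ`. -/
def IsTraceNormForm (γ : Ω[L⁄F]) : Prop :=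
  ∃ (m : ℕ) (v : L) (c : Fin m → F) (u : Fin m → Lˣ),
    Algebra.trace (RatFun F) L v = 0 ∧ (∀ i, Algebra.norm (RatFun F) (u i : L) = 1) ∧
      γ = elemForm v c u

/-- The map `Pr(ξ) = (1/n) ∑_{j < n} ζ⁻ʲ τʲ(ξ)` on one-forms over `L`. -/
def Pr [IsScalarTower F (RatFun F) L] (n : ℕ) (ζ : F) (τ : L ≃ₐ[RatFun F] L)
    (ξ : Ω[L⁄F]) : Ω[L⁄F] :=
  (n : F)⁻¹ • ∑ j ∈ Finset.range n,
    (ζ⁻¹) ^ j • formMap F (((τ ^ j : L ≃ₐ[RatFun F] L) : L →ₐ[RatFun F] L).restrictScalars F) ξ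

end Cyclic

end ElemInt

end

noncomputable section

namespace ElemInt

open KaehlerDifferential

/-! For `ω ≠ 0`, an elementary relation over `M` amounts to an integrating factor `h ≠ 0` in `M`
with `h ω` in the `F`-space `elemForms ⊤ ⊤` (`hasElementaryRelation_iff`). Such forms are closed, so
the ratio `f` of two integrating factors satisfies `df ∧ ω = 0`. If `ω` has no rational first
integral, `f` must be constant (`mem_range_of_wedgeEqZero_D`), so integrating factors are unique up
to constants (`div_mem_range_of_elemForms`).

Now let `ω` be exceptional with a factor `h` in a Galois extension `M`. Each automorphism multiplies
`h` by a constant, so the Galois group of `K(h)` embeds in the multiplicative group of `F` and is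
cyclic. Traces and norms descend the relation to `K(h)`, and `h` cannot lie in `K`. Since `τ` acts
on `ℓ ω` by `ζ`, its average over the group vanishes. Subtracting that average puts any elementary
form into trace-zero, norm-one shape, so `ℓ ω` already has this shape and is fixed by `Pr`.

Conversely, `Pr` projects onto the `ζ`-eigenforms, which are `ℓ` times forms over `K`. A relation
over `K` would give a factor proportional to `ℓ`, contradicting `ℓ ∉ K`. -/

/-! ### Differentials and constants in characteristic zero. -/

/-- Localization followed by a separable algebraic extension makes `L` formally étale over the
polynomial ring in the `x i`, so its differentials are the base change of the free module on the `dX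
i`. -/
theorem exists_basis_kaehlerDifferential {F : Type u} {L : Type v} {ι : Type w} [Field F]
    [CharZero F] [Field L] [Algebra F L] {x : ι → L} (hx : IsTranscendenceBasis F x) :
    ∃ b : Module.Basis ι L Ω[L⁄F], ∀ i, b i = D F L (x i) := by
  let : Algebra (MvPolynomial ι F) L := (MvPolynomial.aeval x).toAlgebra
  have hmap : ∀ p, algebraMap (MvPolynomial ι F) L p = MvPolynomial.aeval x p := fun _ => rfl
  have : IsScalarTower F (MvPolynomial ι F) L :=
    IsScalarTower.of_algebraMap_eq fun r => by simp [hmap]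
  have : FaithfulSMul (MvPolynomial ι F) L :=
    (faithfulSMul_iff_algebraMap_injective _ _).2 hx.1
  have : CharZero (MvPolynomial ι F) := charZero_of_injective_algebraMap
    (MvPolynomial.C_injective ι F)
  have : Algebra.IsAlgebraic (MvPolynomial ι F) L := by
    have := hx.isAlgebraic
    exact Algebra.IsAlgebraic.of_ringHom_of_comp_eq hx.1.aevalEquiv.toRingEquiv.toRingHom
      (RingHom.id L) hx.1.aevalEquiv.surjective Function.injective_id (by
        ext <;> simp [hmap])
  let := FractionRing.liftAlgebra (MvPolynomial ι F) L
  have : Algebra.IsAlgebraic (FractionRing (MvPolynomial ι F)) L :=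
    (IsFractionRing.comap_isAlgebraic_iff (A := MvPolynomial ι F)).1 inferInstance
  have : CharZero (FractionRing (MvPolynomial ι F)) := charZero_of_injective_algebraMap
    (IsFractionRing.injective (MvPolynomial ι F) _)
  have : Algebra.FormallyEtale (FractionRing (MvPolynomial ι F)) L :=
    Algebra.FormallyEtale.of_isSeparable _ _
  have : Algebra.FormallyEtale (MvPolynomial ι F) (FractionRing (MvPolynomial ι F)) :=
    Algebra.FormallyEtale.of_isLocalization (nonZeroDivisors (MvPolynomial ι F))
  have : Algebra.FormallyEtale (MvPolynomial ι F) L :=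
    Algebra.FormallyEtale.comp _ (FractionRing (MvPolynomial ι F)) _
  refine ⟨((mvPolynomialBasis F ι).baseChange L).map
    (tensorKaehlerEquivOfFormallyEtale F (MvPolynomial ι F) L), fun i => ?_⟩
  simp [hmap]

theorem mem_range_of_isIntegral {F : Type u} [Field F] [IsAlgClosed F] {L : Type v}
    [Field L] [Algebra F L] {f : L}
    (hf : IsIntegral F f) : f ∈ Set.range (algebraMap F L) :=
  minpoly.mem_range_of_degree_eq_one F f
    (IsAlgClosed.degree_eq_one_of_irreducible F (minpoly.irreducible hf))

/-- A transcendental `f` extends to a transcendence basis, which makes `df` a basis vector; an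
algebraic `f` lies in the algebraically closed field `F`. -/
theorem D_eq_zero_iff {F : Type u} {L : Type v} [Field F] [IsAlgClosed F]
    [CharZero F] [Field L] [Algebra F L] (f : L) :
    D F L f = 0 ↔ f ∈ Set.range (algebraMap F L) := by
  constructor
  · intro h
    by_cases hf : Transcendental F f
    · exfalso
      have h1 : AlgebraicIndepOn F id ({f} : Set L) :=
        (algebraicIndependent_unique_type_iff (R := F) (x := fun i : ({f} : Set L) => (i : L))).2 hf
      obtain ⟨t, ht, hb⟩ := exists_isTranscendenceBasis_superset h1
      obtain ⟨b, hb⟩ := exists_basis_kaehlerDifferential hb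
      exact b.ne_zero ⟨f, ht rfl⟩ ((hb _).trans h)
    · have hf' : IsAlgebraic F f := not_not.1 hf
      exact mem_range_of_isIntegral hf'.isIntegral
  · rintro ⟨c, rfl⟩
    simp

theorem wedgeEqZero_smul_self {F : Type u} {M : Type v} [Field F] [Field M] [Algebra F M] (c : M)
    (α : Ω[M⁄F]) : WedgeEqZero F (c • α) α := by
  simp [WedgeEqZero]

/-! ### Coordinates with respect to `dx, dy`. -/

section Coordinates

variable (F : Type u) [Field F] [CharZero F] (M : Type v) [Field M] [Algebra F M]
  [Algebra (RatFun F) M] [IsScalarTower F (RatFun F) M] [Algebra.IsAlgebraic (RatFun F) M]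

/-- The variables of `K = F(x, y)`, regarded in an extension `M`. -/
def coordFun (M : Type v) [Field M] [Algebra (RatFun F) M] (i : Fin 2) : M :=
  algebraMap (RatFun F) M (algebraMap (MvPolynomial (Fin 2) F) (RatFun F) (MvPolynomial.X i))

omit [CharZero F] in
theorem isTranscendenceBasis_coordFun : IsTranscendenceBasis F (coordFun F M) := by
  have h : IsTranscendenceBasis F (fun i : Fin 2 =>
      algebraMap (MvPolynomial (Fin 2) F) (RatFun F) (MvPolynomial.X i)) :=
    have : Algebra.IsAlgebraic (MvPolynomial (Fin 2) F) (RatFun F) :=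
      IsLocalization.isAlgebraic _ (nonZeroDivisors (MvPolynomial (Fin 2) F))
    (IsTranscendenceBasis.mvPolynomial (Fin 2) F).algebraMap_comp
  exact h.algebraMap_comp

/-- The basis `dx, dy` of the one-forms over `M`. -/
def formBasis : Module.Basis (Fin 2) M Ω[M⁄F] :=
  (exists_basis_kaehlerDifferential (isTranscendenceBasis_coordFun F M)).choose

theorem formBasis_apply (i : Fin 2) : formBasis F M i = D F M (coordFun F M i) :=
  (exists_basis_kaehlerDifferential (isTranscendenceBasis_coordFun F M)).choose_spec i

/-- The coefficients of a one-form with respect to `dx, dy`. -/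
def coeff (i : Fin 2) : Ω[M⁄F] →ₗ[M] M := (formBasis F M).coord i

/-- The partial derivatives on `M`. -/
def partialDeriv (i : Fin 2) : Derivation F M M := (coeff F M i).compDer (D F M)

variable {F M}

theorem coeff_D (i : Fin 2) (f : M) : coeff F M i (D F M f) = partialDeriv F M i f := rfl

theorem coeff_smul (i : Fin 2) (c : M) (ξ : Ω[M⁄F]) :
    coeff F M i (c • ξ) = c * coeff F M i ξ := map_smul _ _ _

theorem form_ext {ξ η : Ω[M⁄F]} (h : ∀ i, coeff F M i ξ = coeff F M i η) : ξ = η :=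
  (formBasis F M).ext_elem h

theorem form_eq (ξ : Ω[M⁄F]) : ξ = ∑ i, coeff F M i ξ • D F M (coordFun F M i) := by
  simpa [formBasis_apply, coeff] using ((formBasis F M).sum_repr ξ).symm

theorem partialDeriv_coordFun (i j : Fin 2) :
    partialDeriv F M i (coordFun F M j) = if j = i then 1 else 0 := by
  rw [← coeff_D, ← formBasis_apply, coeff, Module.Basis.coord_apply, Module.Basis.repr_self,
    Finsupp.single_apply]

theorem derivation_ext {δ ε : Derivation F M M}
    (h : ∀ i, δ (coordFun F M i) = ε (coordFun F M i)) : δ = ε := by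
  have h1 : δ.liftKaehlerDifferential = ε.liftKaehlerDifferential :=
    (formBasis F M).ext fun i => by simpa [formBasis_apply] using h i
  rw [← δ.liftKaehlerDifferential_comp, h1, ε.liftKaehlerDifferential_comp]

/-- The commutator is a derivation that kills both coordinate functions, hence zero. -/
theorem partialDeriv_comm (i j : Fin 2) (f : M) :
    partialDeriv F M i (partialDeriv F M j f) = partialDeriv F M j (partialDeriv F M i f) := by
  have h : ⁅partialDeriv F M i, partialDeriv F M j⁆ = 0 := derivation_ext fun k => by
    rw [Derivation.commutator_apply, partialDeriv_coordFun, partialDeriv_coordFun]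
    split_ifs <;> simp
  have h2 := congrArg (fun δ : Derivation F M M => δ f) h
  simpa [Derivation.commutator_apply, sub_eq_zero] using h2

theorem wedgeEqZero_iff (α β : Ω[M⁄F]) : WedgeEqZero F α β ↔
    coeff F M 0 α * coeff F M 1 β = coeff F M 1 α * coeff F M 0 β := by
  constructor
  · intro h
    let B : Ω[M⁄F] [⋀^Fin 2]→ₗ[M] M := (formBasis F M).det
    -- The determinant in degree two, and zero in every other degree, extends to a linear functional
    -- on the exterior algebra that detects the wedge product.
    let f : ∀ i, Ω[M⁄F] [⋀^Fin i]→ₗ[M] M := fun i =>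
      if h : i = 2 then B.domDomCongr (finCongr h.symm) else 0
    have h1 : ExteriorAlgebra.liftAlternating f
        (ExteriorAlgebra.ιMulti M 2 ![α, β]) = B ![α, β] := by
      rw [ExteriorAlgebra.liftAlternating_apply_ιMulti]
      simp [f]
    have h2 : ExteriorAlgebra.ιMulti M 2 ![α, β] = 0 := by
      rw [ExteriorAlgebra.ιMulti_apply]
      simpa [WedgeEqZero] using h
    rw [h2, map_zero] at h1
    have h3 : B ![α, β] = coeff F M 0 α * coeff F M 1 β - coeff F M 0 β * coeff F M 1 α := by
      simp only [B, Module.Basis.det_apply, Matrix.det_fin_two, Module.Basis.toMatrix_apply]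
      rfl
    rw [h3] at h1
    linear_combination -h1
  · intro h
    by_cases hα : α = 0
    · simp [hα, WedgeEqZero]
    obtain ⟨c, hc⟩ : ∃ c : M, β = c • α := by
      by_cases h0 : coeff F M 0 α = 0
      · have h1 : coeff F M 1 α ≠ 0 := fun h1 => hα <| form_ext fun i => by
          fin_cases i <;> simp [h0, h1]
        rw [h0, zero_mul, zero_eq_mul, or_iff_right h1] at h
        refine ⟨coeff F M 1 β / coeff F M 1 α, form_ext fun i => ?_⟩
        fin_cases i
        · simp [h0, h]
        · simp [h1]
      · refine ⟨coeff F M 0 β / coeff F M 0 α, form_ext fun i => ?_⟩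
        fin_cases i
        · simp [h0]
        · simp only [Fin.mk_one, map_smul, smul_eq_mul]
          field_simp
          linear_combination h
    simp [WedgeEqZero, hc]

theorem exists_smul_of_wedgeEqZero {α β : Ω[M⁄F]} (hβ : β ≠ 0) (h : WedgeEqZero F α β) :
    ∃ c : M, α = c • β := by
  rw [wedgeEqZero_iff] at h
  by_cases h0 : coeff F M 0 β = 0
  · have h1 : coeff F M 1 β ≠ 0 := fun h1 => hβ <| form_ext fun i => by
      fin_cases i <;> simp [h0, h1]
    rw [h0, mul_zero, mul_eq_zero, or_iff_left h1] at h
    refine ⟨coeff F M 1 α / coeff F M 1 β, form_ext fun i => ?_⟩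
    fin_cases i
    · simp [h0, h]
    · simp [h1]
  · refine ⟨coeff F M 0 α / coeff F M 0 β, form_ext fun i => ?_⟩
    fin_cases i
    · simp [h0]
    · simp only [Fin.mk_one, map_smul, smul_eq_mul]
      field_simp
      linear_combination -h

variable {M' : Type w} [Field M'] [Algebra F M'] [Algebra (RatFun F) M']
  [IsScalarTower F (RatFun F) M'] [Algebra.IsAlgebraic (RatFun F) M']

/-- A `K`-homomorphism preserves `x` and `y`, hence `dx` and `dy`, and so acts only on coefficients.
-/
theorem coeff_formMap (φ : M →ₐ[RatFun F] M') (ξ : Ω[M⁄F]) (i : Fin 2) :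
    coeff F M' i (formMap F (φ.restrictScalars F) ξ) = φ (coeff F M i ξ) := by
  have hφ (j : Fin 2) : φ (coordFun F M j) = coordFun F M' j := by simp [coordFun]
  conv_lhs => rw [form_eq ξ]
  simp only [map_sum, formMap_smul, formMap_D, AlgHom.restrictScalars_apply, hφ, map_smul, coeff_D,
    partialDeriv_coordFun, smul_eq_mul]
  simp

theorem formMap_injective (φ : M →ₐ[RatFun F] M') :
    Function.Injective (formMap F (φ.restrictScalars F)) := fun ξ η h =>
  form_ext fun i => RingHom.injective (φ : M →+* M') <| by
    simpa [coeff_formMap] using congrArg (coeff F M' i) h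

theorem coeff_extendForm (ω : Ω[RatFun F⁄F]) (i : Fin 2) :
    coeff F M i (extendForm F M ω) = algebraMap (RatFun F) M (coeff F (RatFun F) i ω) := by
  have h : extendForm F M ω = formMap F ((Algebra.ofId (RatFun F) M).restrictScalars F) ω := by
    rw [form_eq ω]
    simp only [extendForm, map_sum, map_smul, map_D, formMap_smul, formMap_D]
    simp [Algebra.ofId_apply]
  rw [h, coeff_formMap, Algebra.ofId_apply]

theorem formMap_extendForm (φ : M →ₐ[RatFun F] M') (ω : Ω[RatFun F⁄F]) :
    formMap F (φ.restrictScalars F) (extendForm F M ω) = extendForm F M' ω :=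
  form_ext fun i => by simp [coeff_formMap, coeff_extendForm]

theorem extendForm_self (ω : Ω[RatFun F⁄F]) : extendForm F (RatFun F) ω = ω :=
  form_ext fun i => by simp [coeff_extendForm]

theorem extendForm_eq_zero_iff (ω : Ω[RatFun F⁄F]) : extendForm F M ω = 0 ↔ ω = 0 := by
  rw [← extendForm_self ω, ← formMap_extendForm (Algebra.ofId (RatFun F) M)]
  rw [extendForm_self, map_eq_zero_iff _ (formMap_injective _)]

end Coordinates

/-! ### The space of elementary forms. -/

section Elementary

variable (F : Type u) {M : Type v} {M' : Type w} [Field F] [Field M] [Field M'] [Algebra F M]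
  [Algebra F M']

/-- The logarithmic derivative `u ↦ du / u`. -/
def dlog : Additive Mˣ →+ Ω[M⁄F] where
  toFun u := (u.toMul : M)⁻¹ • D F M (u.toMul : M)
  map_zero' := by simp
  map_add' u v := by
    simp only [toMul_add, Units.val_mul, Derivation.leibniz, smul_add, smul_smul]
    rw [add_comm]
    congr 2 <;> field_simp

theorem dlog_ofMul (u : Mˣ) : dlog F (Additive.ofMul u) = (u : M)⁻¹ • D F M (u : M) := rfl

theorem formMap_dlog (φ : M →ₐ[F] M') (u : Mˣ) :
    formMap F φ (dlog F (Additive.ofMul u)) =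
      dlog F (Additive.ofMul (Units.map (φ : M →* M') u)) := by
  simp [dlog_ofMul, formMap_smul, formMap_D]

variable {F}

/-- The forms `dv + ∑ cᵢ duᵢ / uᵢ` with `v ∈ S` and `uᵢ ∈ U`. -/
def elemForms (S : Submodule F M) (U : Subgroup Mˣ) : Submodule F Ω[M⁄F] :=
  S.map (D F M : M →ₗ[F] Ω[M⁄F]) ⊔ Submodule.span F ((fun u => dlog F (Additive.ofMul u)) '' U)

theorem D_mem_elemForms {S : Submodule F M} (U : Subgroup Mˣ) {v : M} (hv : v ∈ S) :
    D F M v ∈ elemForms S U :=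
  Submodule.mem_sup_left ⟨v, hv, rfl⟩

theorem dlog_mem_elemForms (S : Submodule F M) {U : Subgroup Mˣ} {u : Mˣ} (hu : u ∈ U) :
    dlog F (Additive.ofMul u) ∈ elemForms S U :=
  Submodule.mem_sup_right (Submodule.subset_span ⟨u, hu, rfl⟩)

theorem elemForms_le {S : Submodule F M} {U : Subgroup Mˣ} {N : Submodule F Ω[M⁄F]}
    (hS : ∀ v ∈ S, D F M v ∈ N) (hU : ∀ u ∈ U, dlog F (Additive.ofMul u) ∈ N) :
    elemForms S U ≤ N := by
  refine sup_le ?_ (Submodule.span_le.2 ?_)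
  · rintro _ ⟨v, hv, rfl⟩
    exact hS v hv
  · rintro _ ⟨u, hu, rfl⟩
    exact hU u hu

theorem elemForm_mem_elemForms {S : Submodule F M} {U : Subgroup Mˣ} {m : ℕ} {v : M} (hv : v ∈ S)
    (c : Fin m → F) {u : Fin m → Mˣ} (hu : ∀ i, u i ∈ U) : elemForm v c u ∈ elemForms S U :=
  add_mem (D_mem_elemForms U hv) <| sum_mem fun i _ =>
    Submodule.smul_mem _ _ (dlog_mem_elemForms S (hu i))

theorem mem_elemForms_iff {S : Submodule F M} {U : Subgroup Mˣ} {γ : Ω[M⁄F]} :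
    γ ∈ elemForms S U ↔ ∃ (m : ℕ) (v : M) (c : Fin m → F) (u : Fin m → Mˣ),
      v ∈ S ∧ (∀ i, u i ∈ U) ∧ γ = elemForm v c u := by
  constructor
  · intro h
    obtain ⟨_, ⟨v, hv, rfl⟩, η, hη, rfl⟩ := Submodule.mem_sup.1 h
    obtain ⟨m, c, g, rfl⟩ := Submodule.mem_span_set'.1 hη
    choose u hu hg using fun i => (g i).2
    refine ⟨m, v, c, u, hv, hu, ?_⟩
    simp only [elemForm, ← hg, dlog_ofMul]
    rfl
  · rintro ⟨m, v, c, u, hv, hu, rfl⟩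
    exact elemForm_mem_elemForms hv c hu

theorem mem_elemForms_top_iff {γ : Ω[M⁄F]} :
    γ ∈ elemForms (⊤ : Submodule F M) ⊤ ↔
      ∃ (m : ℕ) (v : M) (c : Fin m → F) (u : Fin m → Mˣ), elemForm v c u = γ := by
  simp [mem_elemForms_iff, eq_comm]

theorem formMap_mem_elemForms (φ : M →ₐ[F] M') {γ : Ω[M⁄F]}
    (h : γ ∈ elemForms (⊤ : Submodule F M) ⊤) :
    formMap F φ γ ∈ elemForms (⊤ : Submodule F M') ⊤ := by
  have h1 : elemForms (⊤ : Submodule F M) ⊤ ≤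
      (elemForms (⊤ : Submodule F M') ⊤).comap (formMap F φ) := by
    refine elemForms_le (fun v _ => ?_) fun u _ => ?_
    · simpa [formMap_D] using D_mem_elemForms _ (Submodule.mem_top)
    · simpa [formMap_dlog] using dlog_mem_elemForms _ (Subgroup.mem_top _)
  exact h1 h

end Elementary

/-! ### Closed forms and first integrals. -/

section Closed

variable {F : Type u} [Field F] [CharZero F] {M : Type v} [Field M] [Algebra F M]
  [Algebra (RatFun F) M] [IsScalarTower F (RatFun F) M] [Algebra.IsAlgebraic (RatFun F) M]

variable (F M) in
/-- The closed one-forms over `M`. -/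
def closedForms : Submodule F Ω[M⁄F] :=
  LinearMap.ker
    ((partialDeriv F M 0 : M →ₗ[F] M) ∘ₗ (coeff F M 1).restrictScalars F -
      (partialDeriv F M 1 : M →ₗ[F] M) ∘ₗ (coeff F M 0).restrictScalars F)

theorem mem_closedForms {ξ : Ω[M⁄F]} : ξ ∈ closedForms F M ↔
    partialDeriv F M 0 (coeff F M 1 ξ) = partialDeriv F M 1 (coeff F M 0 ξ) := by
  simp [closedForms, sub_eq_zero]

theorem elemForms_le_closedForms (S : Submodule F M) (U : Subgroup Mˣ) :
    elemForms S U ≤ closedForms F M := by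
  refine elemForms_le (fun v _ => ?_) fun u _ => ?_
  · rw [mem_closedForms, coeff_D, coeff_D, partialDeriv_comm]
  · rw [mem_closedForms, dlog_ofMul, coeff_smul, coeff_smul, coeff_D, coeff_D, Derivation.leibniz, Derivation.leibniz, Derivation.leibniz_inv,
      Derivation.leibniz_inv, partialDeriv_comm]
    simp only [smul_eq_mul]
    ring

/-- This is `d(f h ω) = df ∧ h ω + f d(h ω)` with both outer differentials zero, after cancelling
`h`. -/
theorem wedgeEqZero_D_of_closed {ω : Ω[M⁄F]} {f h : M} (hh : h ≠ 0)
    (h1 : h • ω ∈ closedForms F M) (h2 : (f * h) • ω ∈ closedForms F M) :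
    WedgeEqZero F (D F M f) ω := by
  rw [mem_closedForms, coeff_smul, coeff_smul] at h1 h2
  rw [mul_assoc, mul_assoc, Derivation.leibniz _ f, Derivation.leibniz _ f, h1] at h2
  rw [wedgeEqZero_iff, coeff_D, coeff_D]
  simp only [smul_eq_mul] at h2
  apply mul_left_cancel₀ hh
  linear_combination h2

theorem partialDeriv_algebraMap (i : Fin 2) (k : RatFun F) :
    partialDeriv F M i (algebraMap (RatFun F) M k) =
      algebraMap (RatFun F) M (partialDeriv F (RatFun F) i k) := by
  have h := coeff_extendForm (M := M) (D F (RatFun F) k) i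
  rwa [extendForm, map_D, coeff_D, coeff_D] at h

/-- The coefficients of the minimal polynomial of a first integral are themselves first integrals in
`K`, hence constants; then `f` is integral over the algebraically closed field `F`. -/
theorem mem_range_of_wedgeEqZero_D [IsAlgClosed F] {ω : Ω[RatFun F⁄F]} (hω : ¬ HasRationalFirstIntegral F ω)
    {f : M} (hf : WedgeEqZero F (D F M f) (extendForm F M ω)) :
    f ∈ Set.range (algebraMap F M) := by
  have hint : IsIntegral (RatFun F) f := Algebra.IsIntegral.isIntegral f
  set p := minpoly (RatFun F) f with hp
  set a := coeff F (RatFun F) 0 ω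
  set b := coeff F (RatFun F) 1 ω
  -- The derivation along the vector field annihilated by `ω`: its kernel consists of the functions
  -- `g` with `dg ∧ ω = 0`. Its extension to `M` is `ε`.
  let δ : Derivation F (RatFun F) (RatFun F) :=
    a • partialDeriv F (RatFun F) 1 - b • partialDeriv F (RatFun F) 0
  let ε : Derivation F M M := algebraMap (RatFun F) M a • partialDeriv F M 1 -
    algebraMap (RatFun F) M b • partialDeriv F M 0
  have hδε : ∀ k, Algebra.linearMap (RatFun F) M (δ k) = ε (algebraMap (RatFun F) M k) := by
    intro k
    simp [δ, ε, partialDeriv_algebraMap, Algebra.smul_def]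
  have hεf : ε f = 0 := by
    rw [wedgeEqZero_iff, coeff_D, coeff_D, coeff_extendForm, coeff_extendForm] at hf
    simp only [ε, Derivation.sub_apply, Derivation.smul_apply, smul_eq_mul]
    linear_combination -hf
  let q : Polynomial (RatFun F) := PolynomialModule.equivPolynomial (δ.mapCoeffs p)
  have hq : ∀ i, q.coeff i = δ (p.coeff i) := fun i => rfl
  have hq0 : Polynomial.aeval f q = 0 := by
    have h := δ.apply_aeval_eq' ε (Algebra.linearMap (RatFun F) M) hδε f p
    rw [hp, minpoly.aeval, map_zero, hεf, smul_zero, add_zero] at h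
    exact (PolynomialModule.aeval_equivPolynomial _ _).trans h.symm
  -- Differentiating `p(f) = 0` along `ε` gives `q(f) = 0`; as `p` is monic, `q` has smaller degree,
  -- so minimality forces `q = 0`.
  have hq1 : q = 0 := by
    by_contra hne
    have h1 := minpoly.degree_le_of_ne_zero (RatFun F) f hne hq0
    have h2 : q.degree < p.degree := by
      rw [Polynomial.degree_eq_natDegree (minpoly.ne_zero hint), Polynomial.degree_lt_iff_coeff_zero]
      intro m hm
      rw [hq]
      rcases hm.eq_or_lt with rfl | hm
      · have := minpoly.monic hint
        rw [Polynomial.Monic, Polynomial.leadingCoeff] at this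
        rw [this]
        simp
      · rw [Polynomial.coeff_eq_zero_of_natDegree_lt hm, map_zero]
    exact absurd h1 (not_le.2 h2)
  have hcoeff : ∀ i, p.coeff i ∈ Set.range (algebraMap F (RatFun F)) := by
    intro i
    by_contra hi
    refine hω ⟨p.coeff i, hi, ?_⟩
    have h := hq i
    rw [hq1, Polynomial.coeff_zero] at h
    simp only [δ, Derivation.sub_apply, Derivation.smul_apply, smul_eq_mul] at h
    rw [wedgeEqZero_iff, coeff_D, coeff_D]
    linear_combination h
  obtain ⟨r, hr⟩ : p ∈ Polynomial.lifts (algebraMap F (RatFun F)) :=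
    (Polynomial.lifts_iff_coeff_lifts p).2 hcoeff
  refine mem_range_of_isIntegral ⟨r, ?_, ?_⟩
  · have := minpoly.monic hint
    rw [← hp, ← hr] at this
    exact Polynomial.monic_of_injective (algebraMap F (RatFun F)).injective this
  · have h := minpoly.aeval (RatFun F) f
    rw [← hp, ← hr] at h
    rwa [Polynomial.coe_mapRingHom, Polynomial.aeval_map_algebraMap] at h

end Closed

/-! ### Elementary relations as integrating factors. -/

section Relations

variable {F : Type u} [Field F] [CharZero F] {M : Type v} [Field M] [Algebra F M]
  [Algebra (RatFun F) M] [IsScalarTower F (RatFun F) M] [Algebra.IsAlgebraic (RatFun F) M]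

theorem hasElementaryRelation_iff {ω : Ω[RatFun F⁄F]} (hω : ω ≠ 0) :
    HasElementaryRelation F M ω ↔
      ∃ h : M, h ≠ 0 ∧ h • extendForm F M ω ∈ elemForms (⊤ : Submodule F M) ⊤ := by
  have hω' : extendForm F M ω ≠ 0 := mt (extendForm_eq_zero_iff ω).1 hω
  constructor
  · rintro ⟨m, v, c, u, h0, hw⟩
    obtain ⟨h, hh⟩ := exists_smul_of_wedgeEqZero hω' hw
    refine ⟨h, ?_, hh ▸ mem_elemForms_top_iff.2 ⟨m, v, c, u, rfl⟩⟩
    rintro rfl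
    exact h0 (by rw [hh, zero_smul])
  · rintro ⟨h, h0, hh⟩
    obtain ⟨m, v, c, u, he⟩ := mem_elemForms_top_iff.1 hh
    refine ⟨m, v, c, u, ?_, ?_⟩
    · rw [he]
      exact smul_ne_zero h0 hω'
    · rw [he]
      exact wedgeEqZero_smul_self _ _

theorem HasRationalFirstIntegral.hasElementaryRelation [IsAlgClosed F] {ω : Ω[RatFun F⁄F]}
    (h : HasRationalFirstIntegral F ω) : HasElementaryRelation F (RatFun F) ω := by
  obtain ⟨f, hf, hw⟩ := h
  have he : elemForm f (![] : Fin 0 → F) ![] = D F (RatFun F) f := by simp [elemForm]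
  refine ⟨0, f, ![], ![], ?_, ?_⟩
  · rw [he]
    exact mt (D_eq_zero_iff f).1 hf
  · rwa [he, extendForm_self]

theorem hasRationalFirstIntegral_zero : HasRationalFirstIntegral F (0 : Ω[RatFun F⁄F]) := by
  refine ⟨coordFun F (RatFun F) 0, ?_, by simp [WedgeEqZero]⟩
  rintro ⟨c, hc⟩
  have h := partialDeriv_coordFun (F := F) (M := RatFun F) 0 0
  rw [← hc, Derivation.map_algebraMap] at h
  simp at h

theorem IsExceptional.not_hasRationalFirstIntegral [IsAlgClosed F] {ω : Ω[RatFun F⁄F]}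
    (h : IsExceptional F ω) : ¬ HasRationalFirstIntegral F ω := fun h1 =>
  h.2 h1.hasElementaryRelation

theorem ne_zero_of_not_hasRationalFirstIntegral {ω : Ω[RatFun F⁄F]}
    (h : ¬ HasRationalFirstIntegral F ω) : ω ≠ 0 := by
  rintro rfl
  exact h hasRationalFirstIntegral_zero

theorem div_mem_range_of_elemForms [IsAlgClosed F] {ω : Ω[RatFun F⁄F]}
    (hω : ¬ HasRationalFirstIntegral F ω) {g h : M} (hh : h ≠ 0)
    (h1 : h • extendForm F M ω ∈ elemForms (⊤ : Submodule F M) ⊤)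
    (h2 : g • extendForm F M ω ∈ elemForms (⊤ : Submodule F M) ⊤) :
    ∃ c : F, g = c • h := by
  obtain ⟨c, hc⟩ := mem_range_of_wedgeEqZero_D hω (f := g / h) <|
    wedgeEqZero_D_of_closed hh (elemForms_le_closedForms _ _ h1)
      (by rw [div_mul_cancel₀ _ hh]; exact elemForms_le_closedForms _ _ h2)
  exact ⟨c, by rw [Algebra.smul_def, hc, div_mul_cancel₀ _ hh]⟩

end Relations

/-! ### The eigenprojection in a cyclic extension. -/

section Cyclic

variable {F : Type u} [Field F] {L : Type v} [Field L] [Algebra F L] [Algebra (RatFun F) L]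

theorem isTraceNormForm_iff {γ : Ω[L⁄F]} [IsScalarTower F (RatFun F) L] : IsTraceNormForm γ ↔
    γ ∈ elemForms ((LinearMap.ker (Algebra.trace (RatFun F) L)).restrictScalars F)
      (Units.map (Algebra.norm (RatFun F) : L →* RatFun F)).ker := by
  simp [IsTraceNormForm, mem_elemForms_iff, MonoidHom.mem_ker, Units.ext_iff]

namespace IsCyclicSetting

variable {n : ℕ} {ζ : F} {τ : L ≃ₐ[RatFun F] L} {ℓ : L} (h : IsCyclicSetting n ζ τ ℓ)

include h

theorem ne_zero : n ≠ 0 := by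
  have := h.one_lt
  lia

theorem finiteDimensional : FiniteDimensional (RatFun F) L :=
  Module.finite_of_finrank_pos (by rw [h.finrank_eq]; exact Nat.pos_of_ne_zero h.ne_zero)

theorem pow_eq_one : τ ^ n = 1 := by
  have := h.finiteDimensional
  have := h.isGalois
  rw [← h.finrank_eq, ← IsGalois.card_aut_eq_finrank]
  exact pow_card_eq_one'

theorem gen_ne_zero : ℓ ≠ 0 := by
  rintro rfl
  have h1 := h.adjoin_eq_top
  rw [IntermediateField.adjoin_zero] at h1
  have h2 := h.one_lt
  rw [← h.finrank_eq, ← IntermediateField.finrank_top', ← h1, IntermediateField.finrank_bot] at h2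
  exact lt_irrefl _ h2

theorem map_pow_eq [IsScalarTower F (RatFun F) L] (j : ℕ) : (τ ^ j) ℓ = ζ ^ j • ℓ := by
  induction j with
  | zero => simp
  | succ j ih =>
    rw [pow_succ', AlgEquiv.mul_apply, ih, pow_succ', mul_comm, mul_smul, ← h.map_eq]
    exact (τ.toLinearMap.restrictScalars F).map_smul _ _

theorem mem_range_of_map_eq {a : L} (ha : τ a = a) : a ∈ Set.range (algebraMap (RatFun F) L) := by
  have := h.finiteDimensional
  have := h.isGalois
  refine (IsGalois.mem_range_algebraMap_iff_fixed a).2 fun σ => ?_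
  have h1 : Subgroup.zpowers τ ≤ MulAction.stabilizer (L ≃ₐ[RatFun F] L) a :=
    Subgroup.zpowers_le.2 ha
  exact h1 (h.generates σ)

theorem gen_not_mem_range : ℓ ∉ Set.range (algebraMap (RatFun F) L) := by
  rintro ⟨k, hk⟩
  have h1 := h.map_eq
  rw [← hk, AlgEquiv.commutes, hk, eq_comm] at h1
  have h2 : ζ = 1 := by
    exact smul_left_injective F h.gen_ne_zero (h1.trans (one_smul F ℓ).symm)
  have h3 := h.isPrimitiveRoot
  rw [h2] at h3
  have := h3.unique IsPrimitiveRoot.one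
  have := h.one_lt
  lia

end IsCyclicSetting

variable [IsScalarTower F (RatFun F) L]

/-- The action of `τʲ` on one-forms. -/
def powFormMap (τ : L ≃ₐ[RatFun F] L) (j : ℕ) : Ω[L⁄F] →ₗ[F] Ω[L⁄F] :=
  formMap F (((τ ^ j : L ≃ₐ[RatFun F] L) : L →ₐ[RatFun F] L).restrictScalars F)

theorem Pr_eq (n : ℕ) (ζ : F) (τ : L ≃ₐ[RatFun F] L) (ξ : Ω[L⁄F]) :
    Pr n ζ τ ξ = (n : F)⁻¹ • ∑ j ∈ Finset.range n, (ζ⁻¹) ^ j • powFormMap τ j ξ := rfl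

theorem powFormMap_D (τ : L ≃ₐ[RatFun F] L) (j : ℕ) (v : L) :
    powFormMap τ j (D F L v) = D F L ((τ ^ j) v) := formMap_D _ _ _

theorem powFormMap_dlog (τ : L ≃ₐ[RatFun F] L) (j : ℕ) (u : Lˣ) :
    powFormMap τ j (dlog F (Additive.ofMul u)) =
      dlog F (Additive.ofMul (Units.map ((τ ^ j : L ≃ₐ[RatFun F] L) : L →* L) u)) :=
  formMap_dlog _ _ _

theorem coeff_powFormMap [CharZero F] [Algebra.IsAlgebraic (RatFun F) L] (τ : L ≃ₐ[RatFun F] L)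
    (j : ℕ) (ξ : Ω[L⁄F]) (i : Fin 2) :
    coeff F L i (powFormMap τ j ξ) = (τ ^ j) (coeff F L i ξ) := coeff_formMap _ _ _

theorem isTraceNormForm_Pr (n : ℕ) (ζ : F) (τ : L ≃ₐ[RatFun F] L) {γ : Ω[L⁄F]}
    (hγ : IsTraceNormForm γ) : IsTraceNormForm (Pr n ζ τ γ) := by
  rw [isTraceNormForm_iff] at hγ ⊢
  refine Submodule.smul_mem _ _ <| sum_mem fun j _ => Submodule.smul_mem _ _ ?_
  refine elemForms_le (N := (elemForms _ _).comap (powFormMap τ j)) (fun v hv => ?_)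
    (fun u hu => ?_) hγ
  · rw [Submodule.mem_comap, powFormMap_D]
    refine D_mem_elemForms _ ?_
    simpa [Algebra.trace_eq_of_algEquiv, -AlgEquiv.coe_pow] using hv
  · rw [Submodule.mem_comap, powFormMap_dlog]
    refine dlog_mem_elemForms _ ?_
    rw [MonoidHom.mem_ker, Units.ext_iff] at hu ⊢
    simpa [Algebra.norm_eq_of_algEquiv, -AlgEquiv.coe_pow] using hu

namespace IsCyclicSetting

variable {n : ℕ} {ζ : F} {τ : L ≃ₐ[RatFun F] L} {ℓ : L} (h : IsCyclicSetting n ζ τ ℓ)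

include h

theorem coeff_Pr_eigen [CharZero F] [Algebra.IsAlgebraic (RatFun F) L] (ξ : Ω[L⁄F]) (i : Fin 2) :
    τ (coeff F L i (Pr n ζ τ ξ)) = ζ • coeff F L i (Pr n ζ τ ξ) := by
  have hζ : ζ ≠ 0 := h.isPrimitiveRoot.ne_zero h.ne_zero
  have hτ (c : F) (a : L) : τ (c • a) = c • τ a := (τ.toLinearMap.restrictScalars F).map_smul c a
  have hc (c : F) (η : Ω[L⁄F]) : coeff F L i (c • η) = c • coeff F L i η :=
    ((coeff F L i).restrictScalars F).map_smul c η
  let g : ℕ → L := fun j => (ζ⁻¹) ^ j • (τ ^ j) (coeff F L i ξ)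
  have hg : coeff F L i (Pr n ζ τ ξ) = (n : F)⁻¹ • ∑ j ∈ Finset.range n, g j := by
    rw [Pr_eq, hc, map_sum]
    simp only [hc, coeff_powFormMap, g]
  have hgτ (j : ℕ) : τ (g j) = ζ • g (j + 1) := by
    simp only [g, hτ, smul_smul, pow_succ' τ, AlgEquiv.mul_apply]
    rw [pow_succ', mul_inv_cancel_left₀ hζ]
  -- The shift by `τ` wraps around because `τ ^ n = 1` and `ζ ^ n = 1`.
  have hgn : g n = g 0 := by
    simp [g, h.pow_eq_one, h.isPrimitiveRoot.pow_eq_one, -AlgEquiv.coe_pow]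
  have hsum : ∑ j ∈ Finset.range n, g (j + 1) = ∑ j ∈ Finset.range n, g j := by
    have h1 := Finset.sum_range_succ g n
    rw [Finset.sum_range_succ', hgn] at h1
    exact add_right_cancel h1
  rw [hg, hτ, map_sum, smul_comm]
  simp only [hgτ, ← Finset.smul_sum, hsum]

/-- The coefficients of the projection and `ℓ` are both multiplied by `ζ` under `τ`, so their
quotients are fixed and lie in `K`. -/
theorem exists_Pr_eq_smul [CharZero F] (ξ : Ω[L⁄F]) :
    ∃ ω : Ω[RatFun F⁄F], Pr n ζ τ ξ = ℓ • extendForm F L ω := by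
  have := h.finiteDimensional
  have h1 (i : Fin 2) : ∃ k : RatFun F, algebraMap (RatFun F) L k =
      coeff F L i (Pr n ζ τ ξ) / ℓ := h.mem_range_of_map_eq <| by
    rw [map_div₀, h.coeff_Pr_eigen, h.map_eq, Algebra.smul_def, Algebra.smul_def,
      mul_div_mul_left _ _
        ((map_ne_zero _).2 (h.isPrimitiveRoot.ne_zero h.ne_zero))]
  choose k hk using h1
  refine ⟨∑ i, k i • D F (RatFun F) (coordFun F (RatFun F) i), form_ext fun i => ?_⟩
  have h2 : coeff F (RatFun F) i (∑ i, k i • D F (RatFun F) (coordFun F (RatFun F) i)) = k i := by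
    simp only [map_sum, coeff_smul, coeff_D, partialDeriv_coordFun]
    simp
  rw [coeff_smul, coeff_extendForm, h2, hk, mul_div_cancel₀ _ h.gen_ne_zero]

theorem powFormMap_smul_extendForm [CharZero F] (ω : Ω[RatFun F⁄F]) (j : ℕ) :
    powFormMap τ j (ℓ • extendForm F L ω) = ζ ^ j • ℓ • extendForm F L ω := by
  have := h.finiteDimensional
  rw [powFormMap, formMap_smul, formMap_extendForm, ← smul_assoc, ← h.map_pow_eq]
  rfl

theorem Pr_smul_extendForm [CharZero F] (ω : Ω[RatFun F⁄F]) :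
    Pr n ζ τ (ℓ • extendForm F L ω) = ℓ • extendForm F L ω := by
  have hζ : ζ ≠ 0 := h.isPrimitiveRoot.ne_zero h.ne_zero
  have hn : (n : F) ≠ 0 := Nat.cast_ne_zero.2 h.ne_zero
  rw [Pr_eq]
  simp only [h.powFormMap_smul_extendForm, smul_smul (_ : F) (_ : F), ← mul_pow,
    inv_mul_cancel₀ hζ, one_pow, one_smul, Finset.sum_const, Finset.card_range]
  rw [← Nat.cast_smul_eq_nsmul F, smul_smul, inv_mul_cancel₀ hn, one_smul]

theorem isTraceNormForm_sub_average [CharZero F] {γ : Ω[L⁄F]}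
    (hγ : γ ∈ elemForms (⊤ : Submodule F L) ⊤) :
    IsTraceNormForm (γ - (n : F)⁻¹ • ∑ j ∈ Finset.range n, powFormMap τ j γ) := by
  have hn : (n : F) ≠ 0 := Nat.cast_ne_zero.2 h.ne_zero
  have hn' : (n : RatFun F) ≠ 0 := by
    rw [← map_natCast (algebraMap F (RatFun F))]
    exact (map_ne_zero _).2 hn
  rw [isTraceNormForm_iff]
  let T : Ω[L⁄F] →ₗ[F] Ω[L⁄F] :=
    LinearMap.id - (n : F)⁻¹ • ∑ j ∈ Finset.range n, powFormMap τ j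
  have hT (ξ : Ω[L⁄F]) : T ξ = ξ - (n : F)⁻¹ • ∑ j ∈ Finset.range n, powFormMap τ j ξ := by
    simp [T]
  rw [← hT]
  refine elemForms_le (N := (elemForms _ _).comap T) (fun v _ => ?_) (fun u _ => ?_) hγ
  · rw [Submodule.mem_comap, hT]
    simp only [powFormMap_D, ← map_sum, ← Derivation.map_smul, ← map_sub]
    refine D_mem_elemForms _ ?_
    have h1 (a : L) : (n : F)⁻¹ • a = (n : RatFun F)⁻¹ • a := by
      rw [← algebraMap_smul (RatFun F) (n : F)⁻¹ a, map_inv₀, map_natCast]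
    rw [Submodule.restrictScalars_mem, LinearMap.mem_ker, map_sub, h1, map_smul, map_sum]
    simp [Algebra.trace_eq_of_algEquiv, hn', -AlgEquiv.coe_pow]
  · rw [Submodule.mem_comap, hT]
    -- Clearing the denominator `n` into the constant leaves an honest unit, whose norm is one
    -- because every conjugate of `u` has the norm of `u`.
    have h1 : dlog F (Additive.ofMul u) -
        (n : F)⁻¹ • ∑ j ∈ Finset.range n, powFormMap τ j (dlog F (Additive.ofMul u)) =
        (n : F)⁻¹ • dlog F (Additive.ofMul (u ^ n / ∏ j ∈ Finset.range n,
          Units.map ((τ ^ j : L ≃ₐ[RatFun F] L) : L →* L) u)) := by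
      simp only [powFormMap_dlog]
      rw [ofMul_div, ofMul_pow, ofMul_prod, map_sub, map_nsmul, map_sum, smul_sub,
        ← Nat.cast_smul_eq_nsmul F, smul_smul, inv_mul_cancel₀ hn, one_smul]
    rw [h1]
    refine Submodule.smul_mem _ _ (dlog_mem_elemForms _ ?_)
    rw [MonoidHom.mem_ker, map_div, map_pow, map_prod, div_eq_one]
    have h2 (j : ℕ) : Units.map (Algebra.norm (RatFun F) : L →* RatFun F)
        (Units.map ((τ ^ j : L ≃ₐ[RatFun F] L) : L →* L) u) =
        Units.map (Algebra.norm (RatFun F) : L →* RatFun F) u := by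
      ext
      simp [Algebra.norm_eq_of_algEquiv, -AlgEquiv.coe_pow]
    simp [h2]

theorem exists_isTraceNormForm [CharZero F] {ω : Ω[RatFun F⁄F]}
    (hω : ℓ • extendForm F L ω ∈ elemForms (⊤ : Submodule F L) ⊤) :
    ∃ γ' : Ω[L⁄F], IsTraceNormForm γ' ∧ Pr n ζ τ γ' = ℓ • extendForm F L ω := by
  -- The witness is `ℓ ω` itself: its average carries the factor `∑ ζ ^ j = 0`, so subtracting the
  -- average changes nothing.
  refine ⟨_, ?_, h.Pr_smul_extendForm ω⟩
  have h1 := h.isTraceNormForm_sub_average hω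
  simp only [h.powFormMap_smul_extendForm, ← Finset.sum_smul,
    h.isPrimitiveRoot.geom_sum_eq_zero h.one_lt] at h1
  simpa using h1

end IsCyclicSetting

end Cyclic

/-! ### Exceptional forms, Galois descent and Kummer theory. -/

theorem IsCyclicSetting.isExceptional {F : Type u} [Field F] [IsAlgClosed F] [CharZero F] {L : Type u} [Field L] [Algebra F L] [Algebra (RatFun F) L]
    [IsScalarTower F (RatFun F) L] {n : ℕ} {ζ : F} {τ : L ≃ₐ[RatFun F] L} {ℓ : L} (h : IsCyclicSetting n ζ τ ℓ)
    {ω : Ω[RatFun F⁄F]} (hω : ¬ HasRationalFirstIntegral F ω)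
    (hγ : ℓ • extendForm F L ω ∈ elemForms (⊤ : Submodule F L) ⊤) : IsExceptional F ω := by
  have := h.finiteDimensional
  have hω0 := ne_zero_of_not_hasRationalFirstIntegral hω
  refine ⟨⟨L, _, _, _, ‹_›, this, (hasElementaryRelation_iff hω0).2 ⟨ℓ, h.gen_ne_zero, hγ⟩⟩, ?_⟩
  rw [hasElementaryRelation_iff hω0]
  rintro ⟨k, hk, hkω⟩
  have h1 := formMap_mem_elemForms ((Algebra.ofId (RatFun F) L).restrictScalars F) hkω
  rw [formMap_smul, formMap_extendForm] at h1
  obtain ⟨c, hc⟩ := div_mem_range_of_elemForms hω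
    ((map_ne_zero (Algebra.ofId (RatFun F) L)).2 hk) h1 hγ
  refine h.gen_not_mem_range ⟨c • k, ?_⟩
  rw [hc, Algebra.ofId_apply]
  simp [Algebra.smul_def, ← IsScalarTower.algebraMap_apply]

/-- Summing over the Galois group turns `dv` into the differential of the trace and `du / u` into
the logarithmic derivative of the norm. -/
theorem exists_sum_formMap_eq {F : Type u} {L : Type v} {M : Type w} [Field F] [Field L] [Field M]
    [Algebra F L] [Algebra F M] [Algebra L M] [IsScalarTower F L M] [FiniteDimensional L M]
    [IsGalois L M] {γ : Ω[M⁄F]} (hγ : γ ∈ elemForms (⊤ : Submodule F M) ⊤) :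
    ∃ δ ∈ elemForms (⊤ : Submodule F L) ⊤,
      ∑ σ : M ≃ₐ[L] M, formMap F ((σ : M →ₐ[L] M).restrictScalars F) γ =
        formMap F (IsScalarTower.toAlgHom F L M) δ := by
  let T : Ω[M⁄F] →ₗ[F] Ω[M⁄F] :=
    ∑ σ : M ≃ₐ[L] M, formMap F ((σ : M →ₐ[L] M).restrictScalars F)
  have h1 : elemForms (⊤ : Submodule F M) ⊤ ≤ ((elemForms (⊤ : Submodule F L) ⊤).map
      (formMap F (IsScalarTower.toAlgHom F L M))).comap T := by
    refine elemForms_le (fun v _ => ?_) fun u _ => ?_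
    · refine ⟨D F L (Algebra.trace L M v), D_mem_elemForms _ Submodule.mem_top, ?_⟩
      simp [T, formMap_D, trace_eq_sum_automorphisms]
    · refine ⟨dlog F (Additive.ofMul (Units.map (Algebra.norm L : M →* L) u)),
        dlog_mem_elemForms _ (Subgroup.mem_top _), ?_⟩
      have h2 : Units.map (IsScalarTower.toAlgHom F L M : L →* M)
          (Units.map (Algebra.norm L : M →* L) u) = ∏ σ : M ≃ₐ[L] M,
            Units.map ((σ : M →ₐ[L] M).restrictScalars F : M →* M) u := by
        ext
        simp [Algebra.norm_eq_prod_automorphisms]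
      simp only [T, LinearMap.sum_apply, formMap_dlog, h2, ofMul_prod, map_sum]
  obtain ⟨δ, hδ, h2⟩ := h1 hγ
  exact ⟨δ, hδ, by simpa [T] using h2.symm⟩

/-- The form is Galois invariant, so its Galois sum is a nonzero integer multiple of it; this sum
descends, and the integer is invertible in `F`. -/
theorem smul_extendForm_mem_elemForms_of_algebraMap {F : Type u} [Field F] [CharZero F]
    {L : Type v} {M : Type w} [Field L] [Field M] [Algebra F L] [Algebra F M]
    [Algebra (RatFun F) L] [Algebra (RatFun F) M] [IsScalarTower F (RatFun F) L]
    [IsScalarTower F (RatFun F) M] [Algebra L M] [IsScalarTower F L M]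
    [IsScalarTower (RatFun F) L M] [Algebra.IsAlgebraic (RatFun F) L]
    [Algebra.IsAlgebraic (RatFun F) M] [FiniteDimensional L M] [IsGalois L M]
    {ω : Ω[RatFun F⁄F]} {h : L}
    (hω : algebraMap L M h • extendForm F M ω ∈ elemForms (⊤ : Submodule F M) ⊤) :
    h • extendForm F L ω ∈ elemForms (⊤ : Submodule F L) ⊤ := by
  obtain ⟨δ, hδ, h1⟩ := exists_sum_formMap_eq (L := L) hω
  have h2 (σ : M ≃ₐ[L] M) : formMap F ((σ : M →ₐ[L] M).restrictScalars F)
      (algebraMap L M h • extendForm F M ω) = algebraMap L M h • extendForm F M ω := by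
    rw [formMap_smul]
    congr 1
    · simp
    · exact formMap_extendForm ((σ : M →ₐ[L] M).restrictScalars (RatFun F)) ω
  have h3 : algebraMap L M h • extendForm F M ω =
      formMap F (IsScalarTower.toAlgHom F L M) (h • extendForm F L ω) := by
    rw [formMap_smul]
    congr 1
    exact (formMap_extendForm (IsScalarTower.toAlgHom (RatFun F) L M) ω).symm
  simp only [h2, Finset.sum_const, Finset.card_univ] at h1
  have hinj : Function.Injective (formMap F (IsScalarTower.toAlgHom F L M)) :=
    formMap_injective (IsScalarTower.toAlgHom (RatFun F) L M)
  rw [h3, ← map_nsmul] at h1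
  rw [← hinj h1, ← Nat.cast_smul_eq_nsmul F] at hδ
  exact (Submodule.smul_mem_iff _ (Nat.cast_ne_zero.2 Fintype.card_ne_zero)).1 hδ

/-- Kummer theory for an element that every automorphism multiplies by a constant. -/
theorem exists_isCyclicSetting_adjoin {F : Type u} [Field F] {M : Type v} [Field M] [Algebra F M]
    [Algebra (RatFun F) M] [IsScalarTower F (RatFun F) M] [FiniteDimensional (RatFun F) M]
    [IsGalois (RatFun F) M] {h : M} (hh : h ∉ Set.range (algebraMap (RatFun F) M))
    (hσ : ∀ σ : M ≃ₐ[RatFun F] M, ∃ c : F, σ h = c • h) :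
    ∃ (n : ℕ) (ζ : F) (τ : (RatFun F)⟮h⟯ ≃ₐ[RatFun F] (RatFun F)⟮h⟯),
      IsCyclicSetting n ζ τ (IntermediateField.AdjoinSimple.gen (RatFun F) h) := by
  set L := (RatFun F)⟮h⟯ with hL
  set ℓ : L := IntermediateField.AdjoinSimple.gen (RatFun F) h
  have hh0 : h ≠ 0 := by
    rintro rfl
    exact hh ⟨0, map_zero _⟩
  have hℓ0 : ℓ ≠ 0 := fun h0 => hh0 (congrArg (algebraMap L M) h0)
  have : Normal (RatFun F) L := by
    refine IntermediateField.normal_iff_forall_map_le'.2 fun σ => ?_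
    rw [hL, IntermediateField.adjoin_map, IntermediateField.adjoin_le_iff]
    rintro _ ⟨x, hx, rfl⟩
    rw [Set.mem_singleton_iff.1 hx]
    obtain ⟨c, hc⟩ := hσ σ
    have h1 : c • h ∈ L := by
      rw [← algebraMap_smul (RatFun F) c h]
      exact L.smul_mem (IntermediateField.mem_adjoin_simple_self _ h)
    simpa [hc] using h1
  have hgal : IsGalois (RatFun F) L := {}
  have htop : (RatFun F)⟮ℓ⟯ = ⊤ := by
    apply IntermediateField.lift_injective L
    rw [IntermediateField.lift_adjoin_simple, IntermediateField.lift_top]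
    rfl
  have hχ (σ : L ≃ₐ[RatFun F] L) : ∃ c : F, σ ℓ = c • ℓ := by
    obtain ⟨c, hc⟩ := hσ (σ.liftNormal M)
    refine ⟨c, (algebraMap L M).injective ?_⟩
    rw [← AlgEquiv.liftNormal_commutes]
    exact hc
  choose χ hχ using hχ
  have hinj1 : Function.Injective fun c : F => c • ℓ := smul_left_injective F hℓ0
  have hsmul (σ : L ≃ₐ[RatFun F] L) (c : F) (a : L) : σ (c • a) = c • σ a :=
    (σ.toLinearMap.restrictScalars F).map_smul c a
  -- The Kummer character. It is injective because `ℓ` generates `L`, and a finite group embedding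
  -- in the multiplicative monoid of a field is cyclic.
  let χ' : (L ≃ₐ[RatFun F] L) →* F :=
    { toFun := χ
      map_one' := hinj1 (by simp [← hχ])
      map_mul' := fun σ τ => hinj1 (by
        simp only [← hχ, AlgEquiv.mul_apply]
        rw [hχ τ, hsmul, hχ σ, smul_smul, mul_comm]) }
  have hinj : Function.Injective χ' := by
    intro σ τ hστ
    have h1 : (σ : L →ₐ[RatFun F] L).comp IntermediateField.topEquiv.toAlgHom =
        (τ : L →ₐ[RatFun F] L).comp IntermediateField.topEquiv.toAlgHom := by
      refine IntermediateField.algHom_ext_of_eq_adjoin (RatFun F) htop.symm ?_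
      rintro _ rfl
      change σ ℓ = τ ℓ
      rw [hχ, hχ]
      exact congrArg (· • ℓ) hστ
    ext a
    have h2 := DFunLike.congr_fun h1 ⟨a, trivial⟩
    exact congrArg (algebraMap L M) h2
  have hcyc : IsCyclic (L ≃ₐ[RatFun F] L) := isCyclic_of_injective_ringHom χ' hinj
  obtain ⟨τ, hτ⟩ := hcyc.exists_generator
  refine ⟨Module.finrank (RatFun F) L, χ τ, τ, ?_, rfl, hgal, hτ, ?_, htop, hχ τ⟩
  · refine lt_of_le_of_ne Module.finrank_pos fun h1 => hh ?_
    have h2 := IntermediateField.finrank_eq_one_iff.1 h1.symm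
    have h3 : h ∈ L := IntermediateField.mem_adjoin_simple_self _ h
    rw [h2] at h3
    exact IntermediateField.mem_bot.1 h3
  -- Injectivity of the character gives `χ τ` the order of the generator `τ`, which is the degree.
  · rw [← IsGalois.card_aut_eq_finrank, ← orderOf_eq_card_of_forall_mem_zpowers hτ,
      ← orderOf_injective χ' hinj τ]
    exact IsPrimitiveRoot.orderOf (χ τ)

/-- An integrating factor survives passage to the normal closure, which is Galois in characteristic
zero. -/
theorem IsExceptional.exists_isGalois {F : Type u} [Field F] [IsAlgClosed F] [CharZero F]
    {ω : Ω[RatFun F⁄F]} (hω : IsExceptional F ω) :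
    ∃ (M : Type u) (_ : Field M) (_ : Algebra F M) (_ : Algebra (RatFun F) M)
      (_ : IsScalarTower F (RatFun F) M), FiniteDimensional (RatFun F) M ∧
      IsGalois (RatFun F) M ∧
      ∃ h : M, h ≠ 0 ∧ h • extendForm F M ω ∈ elemForms (⊤ : Submodule F M) ⊤ := by
  have hω0 := ne_zero_of_not_hasRationalFirstIntegral hω.not_hasRationalFirstIntegral
  obtain ⟨⟨M, _, _, _, _, _, hM⟩, -⟩ := hω
  obtain ⟨h, hh, hhω⟩ := (hasElementaryRelation_iff hω0).1 hM
  have : CharZero (RatFun F) := charZero_of_injective_algebraMap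
    (algebraMap F (RatFun F)).injective
  have hA : Algebra.IsAlgebraic (RatFun F) (AlgebraicClosure M) :=
    Algebra.IsAlgebraic.trans (RatFun F) M (AlgebraicClosure M)
  have hN : Normal (RatFun F) (AlgebraicClosure M) :=
    have : IsAlgClosure (RatFun F) (AlgebraicClosure M) := ⟨inferInstance, hA⟩
    IsAlgClosure.normal _ _
  let N := IntermediateField.normalClosure (RatFun F) M (AlgebraicClosure M)
  have hfin : FiniteDimensional (RatFun F) N := normalClosure.is_finiteDimensional _ _ _
  have hnorm : Normal (RatFun F) N := normalClosure.normal _ _ _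
  have hst : IsScalarTower F (RatFun F) N := inferInstance
  refine ⟨N, inferInstance, inferInstance, inferInstance, hst, hfin, {}, ?_⟩
  let φ : M →ₐ[RatFun F] N := IsScalarTower.toAlgHom (RatFun F) M N
  refine ⟨φ h, (map_ne_zero φ).2 hh, ?_⟩
  have h1 := formMap_mem_elemForms (φ.restrictScalars F) hhω
  rwa [formMap_smul, formMap_extendForm] at h1

theorem IsExceptional.exists_isCyclicSetting {F : Type u} [Field F] [IsAlgClosed F] [CharZero F]
    {ω : Ω[RatFun F⁄F]} (hω : IsExceptional F ω) :
    ∃ (L : Type u) (_ : Field L) (_ : Algebra F L) (_ : Algebra (RatFun F) L)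
      (_ : IsScalarTower F (RatFun F) L) (n : ℕ) (ζ : F) (τ : L ≃ₐ[RatFun F] L) (ℓ : L),
      IsCyclicSetting n ζ τ ℓ ∧ ℓ • extendForm F L ω ∈ elemForms (⊤ : Submodule F L) ⊤ := by
  have hfi := hω.not_hasRationalFirstIntegral
  obtain ⟨M, _, _, _, _, _, _, h, hh, hhω⟩ := hω.exists_isGalois
  -- Since `ω` is defined over `K`, `σ h` is again an integrating factor, hence a constant multiple
  -- of `h`.
  have hσ (σ : M ≃ₐ[RatFun F] M) : ∃ c : F, σ h = c • h := by
    have h1 := formMap_mem_elemForms ((σ : M →ₐ[RatFun F] M).restrictScalars F) hhω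
    rw [formMap_smul, formMap_extendForm] at h1
    exact div_mem_range_of_elemForms hfi hh hhω h1
  -- If `h` were in `K`, descent from `M` would give an elementary relation over `K`.
  have hrange : h ∉ Set.range (algebraMap (RatFun F) M) := by
    rintro ⟨k, rfl⟩
    refine hω.2 ((hasElementaryRelation_iff (ne_zero_of_not_hasRationalFirstIntegral hfi)).2
      ⟨k, ?_, smul_extendForm_mem_elemForms_of_algebraMap hhω⟩)
    rintro rfl
    exact hh (map_zero _)
  obtain ⟨n, ζ, τ, hcyc⟩ := exists_isCyclicSetting_adjoin hrange hσ
  have := hcyc.finiteDimensional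
  have : IsScalarTower F (RatFun F)⟮h⟯ M := IsScalarTower.of_algebraMap_eq fun c => by
    rw [IsScalarTower.algebraMap_apply F (RatFun F) M,
      IsScalarTower.algebraMap_apply F (RatFun F) (RatFun F)⟮h⟯,
      ← IsScalarTower.algebraMap_apply (RatFun F) (RatFun F)⟮h⟯ M]
  exact ⟨(RatFun F)⟮h⟯, inferInstance, inferInstance, inferInstance, inferInstance, n, ζ, τ, _, hcyc,
    smul_extendForm_mem_elemForms_of_algebraMap (M := M) hhω⟩

end ElemInt

end

theorem mainTheorem5 {F : Type u} [Field F] [IsAlgClosed F] [CharZero F] :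
    (∀ (L : Type u) [Field L] [Algebra F L] [Algebra (ElemInt.RatFun F) L]
        [IsScalarTower F (ElemInt.RatFun F) L]
        (n : ℕ) (ζ : F) (τ : L ≃ₐ[ElemInt.RatFun F] L) (ℓ : L),
        ElemInt.IsCyclicSetting n ζ τ ℓ →
        (∀ γ' : Ω[L⁄F], ElemInt.IsTraceNormForm γ' →
          ElemInt.IsTraceNormForm (ElemInt.Pr n ζ τ γ') ∧
          ∃ ω : Ω[ElemInt.RatFun F⁄F],
            ElemInt.Pr n ζ τ γ' = ℓ • ElemInt.extendForm F L ω) ∧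
        (∀ (γ' : Ω[L⁄F]) (ω : Ω[ElemInt.RatFun F⁄F]), ElemInt.IsTraceNormForm γ' →
          ElemInt.Pr n ζ τ γ' = ℓ • ElemInt.extendForm F L ω →
          ¬ ElemInt.HasRationalFirstIntegral F ω → ElemInt.IsExceptional F ω) ∧
        (∀ ω : Ω[ElemInt.RatFun F⁄F], ElemInt.IsExceptional F ω →
          (∃ (m : ℕ) (v : L) (c : Fin m → F) (u : Fin m → Lˣ),
            ElemInt.elemForm v c u = ℓ • ElemInt.extendForm F L ω) →
          ∃ γ' : Ω[L⁄F], ElemInt.IsTraceNormForm γ' ∧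
            ElemInt.Pr n ζ τ γ' = ℓ • ElemInt.extendForm F L ω)) ∧
    (∀ ω : Ω[ElemInt.RatFun F⁄F], ElemInt.IsExceptional F ω →
      ∃ (L : Type u) (_ : Field L) (_ : Algebra F L) (_ : Algebra (ElemInt.RatFun F) L)
        (_ : IsScalarTower F (ElemInt.RatFun F) L)
        (n : ℕ) (ζ : F) (τ : L ≃ₐ[ElemInt.RatFun F] L) (ℓ : L) (γ' : Ω[L⁄F]),
        ElemInt.IsCyclicSetting n ζ τ ℓ ∧ ElemInt.IsTraceNormForm γ' ∧
          ElemInt.Pr n ζ τ γ' = ℓ • ElemInt.extendForm F L ω) := by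
  refine ⟨fun L _ _ _ _ n ζ τ ℓ h => ⟨fun γ' hγ => ⟨?_, h.exists_Pr_eq_smul γ'⟩, ?_, ?_⟩, ?_⟩
  · exact ElemInt.isTraceNormForm_Pr n ζ τ hγ
  · intro γ' ω hγ hPr hω
    obtain ⟨m, v, c, u, -, -, he⟩ := ElemInt.isTraceNormForm_Pr n ζ τ hγ
    exact h.isExceptional hω (hPr ▸ ElemInt.mem_elemForms_top_iff.2 ⟨m, v, c, u, he.symm⟩)
  · intro ω _ hω
    exact h.exists_isTraceNormForm (ElemInt.mem_elemForms_top_iff.2 hω)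
  · intro ω hω
    obtain ⟨L, _, _, _, _, n, ζ, τ, ℓ, h, hℓ⟩ := hω.exists_isCyclicSetting
    obtain ⟨γ', hγ, hPr⟩ := h.exists_isTraceNormForm hℓ
    exact ⟨L, _, _, _, ‹_›, n, ζ, τ, ℓ, γ', h, hγ, hPr⟩
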